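/- Let $k\ge 0$, let $m_1,\dots,m_k$ be positive integers and let $n$ be a natural number. Let $\mathbf{Cstar}([m_1,\dots,m_k],[n])$ be the set of unital $*$-homomorphisms $\bigoplus_{i=1}^k\mathcal M_{m_i}(\mathbb C)\to\mathcal M_n(\mathbb C)$, with the topology induced by the operator norm $\|f\|_{op}=\sup_{\|a\|=1}\|f(a)\|$, where matrix algebras carry the spectral norm and direct sums the maximum of the spectral norms of the components. Let $B_n^{\bar m}$ be the set of $(n,\bar m)$-Bratteli tuples, i.e. of tuples $\bar s=(s_1,\dots,s_k)$ of natural numbers with $\sum_i s_im_i=n$. For $\bar s\in B_n^{\bar m}$ let $$G_{\bar s,\bar m,n}=\{\,u_1\otimes \mathrm{Id}_{m_1}\oplus\dots\oplus u_k\otimes \mathrm{Id}_{m_k} : u_i\in\mathbb U(s_i)\,\}\subset\mathbb U(n),$$ where $\oplus$ of matrices is the block diagonal matrix and $\otimes$ is the Kronecker product, $(U\otimes V)_{im+k,\,jm+l}=U_{i,j}V_{k,l}$ (indices starting at $0$) for $V$ of size $m$. This is a subgroup of $\mathbb U(n)$ (which has the topology of the spectral norm), acting by right multiplication. Then there is a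 homeomorphism $$\coprod_{\bar s\in B_n^{\bar m}}\mathbb U(n)/G_{\bar s,\bar m,n}\;\cong\;\mathbf{Cstar}\big([m_1,\dots,m_k],[n]\big),$$ where the quotients have the quotient topology and the left side the disjoint union topology; explicitly, the map that sends the class of $U\in\mathbb U(n)$ in the component of $\bar s$ to the $*$-homomorphism $$(A_1,\dots,A_k)\mapsto U\big(\mathrm{Id}_{s_1}\otimes A_1\oplus\dots\oplus \mathrm{Id}_{s_k}\otimes A_k\big)U^*$$ is well defined and is a homeomorphism. -/

import Mathlib

open scoped Matrix.Norms.L2Operator Kronecker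

/-- The C*-algebra `⊕ i, M_{m i}(ℂ)`. With the scoped instances opened above, each matrix algebra
carries the spectral norm and the direct sum the maximum of the norms of the components, which is
the spectral norm of the corresponding block diagonal matrix. -/
abbrev MatSum {k : ℕ} (m : Fin k → ℕ) : Type :=
  ∀ i, Matrix (Fin (m i)) (Fin (m i)) ℂ

/-- The hom-set `Cstar([m₁,…,m_k],[n₁,…,n_p])`: the unital `*`-homomorphisms
`⊕ i, M_{m i}(ℂ) → ⊕ j, M_{n j}(ℂ)`. -/
def CstarHom {k p : ℕ} (m : Fin k → ℕ) (n : Fin p → ℕ) : Type :=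
  MatSum m →⋆ₐ[ℂ] MatSum n

namespace CstarHom

variable {k p : ℕ} {m : Fin k → ℕ} {n : Fin p → ℕ}

instance : FunLike (CstarHom m n) (MatSum m) (MatSum n) :=
  inferInstanceAs (FunLike (MatSum m →⋆ₐ[ℂ] MatSum n) (MatSum m) (MatSum n))

/-- A morphism as an element of the normed space of bounded linear maps, with the operator norm. -/
noncomputable def toCLM (f : CstarHom m n) : MatSum m →L[ℂ] MatSum n :=
  LinearMap.toContinuousLinearMap (StarAlgHom.toAlgHom f).toLinearMap

theorem toCLM_injective :
    Function.Injective (toCLM : CstarHom m n → (MatSum m →L[ℂ] MatSum n)) := by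
  intro f g h
  refine StarAlgHom.ext (fun a => ?_)
  exact DFunLike.congr_fun h a

/-- The distance `‖f - g‖` in operator norm. -/
noncomputable instance : MetricSpace (CstarHom m n) :=
  MetricSpace.induced toCLM toCLM_injective inferInstance

end CstarHom

/-- The `(n, m)`-Bratteli tuples: `s` with `∑ i, s i * m i = n`. -/
def BratteliTuple {k : ℕ} (m : Fin k → ℕ) (n : ℕ) : Type :=
  {s : Fin k → ℕ // ∑ i, s i * m i = n}

namespace BratteliTuple

variable {k : ℕ} {m : Fin k → ℕ} {n : ℕ}

/-- The block ordering of `{0,…,n-1}`: the blocks `i = 1,…,k` come one after the other, block `i`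
has size `s i * m i`, and `(a, b)` in it is at position `a * m i + b` (the usual indexing of
Kronecker products). -/
def indexEquiv (s : BratteliTuple m n) : (Σ i, Fin (s.1 i) × Fin (m i)) ≃ Fin n :=
  ((Equiv.sigmaCongrRight fun _ => finProdFinEquiv).trans finSigmaFinEquiv).trans (finCongr s.2)

/-- The `n × n` block diagonal matrix `⊕ i, u i ⊗ A i`, with `u i` of size `s i` and `A i` of
size `m i`. -/
def block (s : BratteliTuple m n) (u : ∀ i, Matrix (Fin (s.1 i)) (Fin (s.1 i)) ℂ)
    (A : MatSum m) : Matrix (Fin n) (Fin n) ℂ :=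
  Matrix.reindex s.indexEquiv s.indexEquiv (Matrix.blockDiagonal' fun i => u i ⊗ₖ A i)

theorem block_one (s : BratteliTuple m n) : s.block (fun _ => 1) (fun _ => 1) = 1 := by
  have h : (fun i => (1 : Matrix (Fin (s.1 i)) (Fin (s.1 i)) ℂ) ⊗ₖ
      (1 : Matrix (Fin (m i)) (Fin (m i)) ℂ)) = 1 := by
    funext i
    exact Matrix.one_kronecker_one
  rw [block, h, Matrix.blockDiagonal'_one]
  simp

theorem block_mul (s : BratteliTuple m n) (u v : ∀ i, Matrix (Fin (s.1 i)) (Fin (s.1 i)) ℂ)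
    (A B : MatSum m) :
    s.block u A * s.block v B = s.block (fun i => u i * v i) (fun i => A i * B i) := by
  simp only [block, Matrix.reindex_apply, Matrix.submatrix_mul_equiv, Matrix.mul_kronecker_mul,
    Matrix.blockDiagonal'_mul]

theorem star_block (s : BratteliTuple m n) (u : ∀ i, Matrix (Fin (s.1 i)) (Fin (s.1 i)) ℂ)
    (A : MatSum m) : star (s.block u A) = s.block (fun i => star (u i)) (fun i => star (A i)) := by
  simp only [block, Matrix.star_eq_conjTranspose, Matrix.reindex_apply,
    Matrix.conjTranspose_submatrix, Matrix.blockDiagonal'_conjTranspose,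
    Matrix.conjTranspose_kronecker]

/-- The subgroup `{u₁ ⊗ Id_{m₁} ⊕ … ⊕ u_k ⊗ Id_{m_k} : u i ∈ U(s i)}` of `U(n)`. -/
def unitarySubgroup (s : BratteliTuple m n) : Subgroup (Matrix.unitaryGroup (Fin n) ℂ) where
  carrier := {W | ∃ u : ∀ i, Matrix.unitaryGroup (Fin (s.1 i)) ℂ,
    (W : Matrix (Fin n) (Fin n) ℂ) = s.block (fun i => (u i : Matrix _ _ ℂ)) (fun _ => 1)}
  mul_mem' := by
    rintro V W ⟨u, hu⟩ ⟨v, hv⟩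
    refine ⟨fun i => u i * v i, ?_⟩
    simp [hu, hv, block_mul]
  one_mem' := ⟨fun _ => 1, by simpa using s.block_one.symm⟩
  inv_mem' := by
    rintro W ⟨u, hu⟩
    refine ⟨fun i => star (u i), ?_⟩
    have h : ((W⁻¹ : Matrix.unitaryGroup (Fin n) ℂ) : Matrix (Fin n) (Fin n) ℂ) =
      star (W : Matrix (Fin n) (Fin n) ℂ) := rfl
    rw [h, hu, star_block]
    simp

end BratteliTuple

/-! A continuous bijection from a compact space to a Hausdorff space is a homeomorphism. The source
is compact because unitary groups are compact and, as every `m i` is positive, there are finitely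
many Bratteli tuples; the target is metric. For injectivity, traces of minimal projections recover
the multiplicities (`eq_of_conjHom_eq`). For a fixed tuple, two unitaries with the same image differ
by a unitary in the commutant of the matrices `⊕ i, 1 ⊗ A i`, and that commutant is `{⊕ i, u i ⊗ 1}`
(`exists_eq_block_of_commute`). Surjectivity is the decomposition of a representation on `ℂⁿ` into
multiples of standard ones, obtained from the images of matrix units
(`exists_orthonormalBasis_of_representation`). -/

instance Matrix.unitaryGroup.compactSpace {ι : Type*} [Fintype ι] [DecidableEq ι] :
    CompactSpace (Matrix.unitaryGroup ι ℂ) := by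
  have : ProperSpace (Matrix ι ι ℂ) := FiniteDimensional.proper ℂ _
  refine isCompact_iff_compactSpace.mp (Metric.isCompact_of_isClosed_isBounded
    (isClosed_unitary (R := Matrix ι ι ℂ)) ?_)
  refine isBounded_iff_forall_norm_le.mpr ⟨1, fun U hU => ?_⟩
  -- Unitaries have norm 1 only in a nontrivial ring; an empty index type gives the zero ring.
  rcases subsingleton_or_nontrivial (Matrix ι ι ℂ) with h | h
  · rw [Subsingleton.elim U 0, norm_zero]
    exact zero_le_one
  · exact (CStarRing.norm_of_mem_unitary hU).le

/-! ### Conjugation homomorphisms, multiplicities and commutants. -/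

namespace BratteliTuple

variable {k : ℕ} {m : Fin k → ℕ} {n : ℕ}

theorem finite (hm : ∀ i, 0 < m i) : Finite (BratteliTuple m n) := by
  refine Finite.of_injective (β := ∀ _ : Fin k, Fin (n + 1))
    (fun s i => ⟨s.1 i, Nat.lt_succ_of_le ?_⟩) fun s t h => Subtype.ext (funext fun i => ?_)
  · calc s.1 i ≤ s.1 i * m i := Nat.le_mul_of_pos_right _ (hm i)
      _ ≤ ∑ j, s.1 j * m j :=
        Finset.single_le_sum (f := fun j => s.1 j * m j) (fun _ _ => Nat.zero_le _)
          (Finset.mem_univ i)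
      _ = n := s.2
  · exact congrArg Fin.val (congrFun h i)

theorem block_add_right (s : BratteliTuple m n) (u : ∀ i, Matrix (Fin (s.1 i)) (Fin (s.1 i)) ℂ)
    (A B : MatSum m) : s.block u (A + B) = s.block u A + s.block u B := by
  have h : (fun i => u i ⊗ₖ (A + B) i) = (fun i => u i ⊗ₖ A i) + fun i => u i ⊗ₖ B i := by
    funext i
    exact Matrix.kronecker_add _ _ _
  rw [block, block, block, h, Matrix.blockDiagonal'_add]
  rfl

theorem block_smul_right (s : BratteliTuple m n) (u : ∀ i, Matrix (Fin (s.1 i)) (Fin (s.1 i)) ℂ)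
    (c : ℂ) (A : MatSum m) : s.block u (c • A) = c • s.block u A := by
  have h : (fun i => u i ⊗ₖ (c • A) i) = c • fun i => u i ⊗ₖ A i := by
    funext i
    exact Matrix.kronecker_smul c (u i) (A i)
  rw [block, block, h, Matrix.blockDiagonal'_smul]
  rfl

/-- The unital `*`-homomorphism `A ↦ ⊕ i, 1 ⊗ A i`. -/
def blockHom (s : BratteliTuple m n) : MatSum m →⋆ₐ[ℂ] Matrix (Fin n) (Fin n) ℂ where
  toFun := s.block fun _ => 1
  map_one' := s.block_one
  map_mul' A B := by
    rw [block_mul]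
    simp only [mul_one]
    rfl
  map_zero' := by simpa using s.block_smul_right (fun _ => 1) 0 0
  map_add' := s.block_add_right _
  commutes' c := by
    rw [Algebra.algebraMap_eq_smul_one, Algebra.algebraMap_eq_smul_one, block_smul_right]
    exact congrArg (c • ·) s.block_one
  map_star' A := by
    rw [star_block]
    simp only [star_one]
    rfl

theorem blockHom_apply (s : BratteliTuple m n) (A : MatSum m) :
    s.blockHom A = s.block (fun _ => 1) A := rfl

/-- The unital `*`-homomorphism `A ↦ U (⊕ i, 1 ⊗ A i) U*`. -/
def conjHom (s : BratteliTuple m n) (U : Matrix.unitaryGroup (Fin n) ℂ) :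
    CstarHom m (fun _ : Fin 1 => n) :=
  { toFun := fun A _ => (U : Matrix (Fin n) (Fin n) ℂ) * s.block (fun _ => 1) A *
      star (U : Matrix (Fin n) (Fin n) ℂ)
    map_one' := by
      funext _
      rw [← blockHom_apply, map_one, mul_one]
      exact Unitary.mul_star_self_of_mem U.2
    map_mul' := fun A B => by
      funext _
      have hU : star (U : Matrix (Fin n) (Fin n) ℂ) * U = 1 := Unitary.star_mul_self_of_mem U.2
      simp only [← blockHom_apply, map_mul, Pi.mul_apply]
      simp only [mul_assoc]
      rw [← mul_assoc (star (U : Matrix (Fin n) (Fin n) ℂ)) U, hU, one_mul]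
    map_zero' := by
      funext _
      rw [← blockHom_apply, map_zero, mul_zero, zero_mul]
      rfl
    map_add' := fun A B => by
      funext _
      simp only [← blockHom_apply, map_add, mul_add, add_mul, Pi.add_apply]
    commutes' := fun c => by
      funext _
      have hU : (U : Matrix (Fin n) (Fin n) ℂ) * star (U : Matrix (Fin n) (Fin n) ℂ) = 1 :=
        Unitary.mul_star_self_of_mem U.2
      rw [← blockHom_apply, Algebra.algebraMap_eq_smul_one, map_smul, map_one, mul_smul_comm,
        mul_one, smul_mul_assoc, hU, Algebra.algebraMap_eq_smul_one]
      rfl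
    map_star' := fun A => by
      funext _
      simp only [← blockHom_apply, map_star, Pi.star_apply, star_mul, star_star, mul_assoc] }

theorem conjHom_apply (s : BratteliTuple m n) (U : Matrix.unitaryGroup (Fin n) ℂ) (A : MatSum m) :
    s.conjHom U A = fun _ => (U : Matrix (Fin n) (Fin n) ℂ) * s.block (fun _ => 1) A *
      star (U : Matrix (Fin n) (Fin n) ℂ) := rfl

theorem continuous_conjHom (s : BratteliTuple m n) : Continuous s.conjHom := by
  have hi : Topology.IsInducing
      (CstarHom.toCLM : CstarHom m (fun _ : Fin 1 => n) → _) := ⟨rfl⟩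
  -- The domain `MatSum m` is finite-dimensional, so operator-norm continuity may be checked
  -- pointwise.
  refine hi.continuous_iff.mpr (continuous_clm_apply.mpr fun A => ?_)
  refine continuous_pi fun _ => ?_
  exact (continuous_subtype_val.mul continuous_const).mul continuous_subtype_val.star

/-- `u ⊗ 1` commutes with `1 ⊗ A`, so conjugation by `W` fixes every `⊕ i, 1 ⊗ A i`. -/
theorem conjHom_mul_of_mem (s : BratteliTuple m n) (U W : Matrix.unitaryGroup (Fin n) ℂ)
    (hW : W ∈ s.unitarySubgroup) : s.conjHom (U * W) = s.conjHom U := by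
  obtain ⟨u, hu⟩ := hW
  refine DFunLike.ext _ _ fun A => funext fun _ => ?_
  have h : (W : Matrix (Fin n) (Fin n) ℂ) * s.block (fun _ => 1) A *
      star (W : Matrix (Fin n) (Fin n) ℂ) = s.block (fun _ => 1) A := by
    rw [hu, star_block, block_mul, block_mul]
    simp
  simp only [conjHom_apply, Submonoid.coe_mul, star_mul]
  conv_rhs => rw [← h]
  simp only [mul_assoc]

theorem block_apply (s : BratteliTuple m n) (u : ∀ i, Matrix (Fin (s.1 i)) (Fin (s.1 i)) ℂ)
    (A : MatSum m) (i : Fin k) (a a' : Fin (s.1 i)) (x x' : Fin (m i)) :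
    s.block u A (s.indexEquiv ⟨i, a, x⟩) (s.indexEquiv ⟨i, a', x'⟩) = u i a a' * A i x x' := by
  simp [block]

theorem block_apply_ne (s : BratteliTuple m n) (u : ∀ i, Matrix (Fin (s.1 i)) (Fin (s.1 i)) ℂ)
    (A : MatSum m) {p q : Σ i, Fin (s.1 i) × Fin (m i)} (h : p.1 ≠ q.1) :
    s.block u A (s.indexEquiv p) (s.indexEquiv q) = 0 := by
  simp [block, Matrix.blockDiagonal'_apply, h]

theorem trace_block (s : BratteliTuple m n) (A : MatSum m) :
    (s.block (fun _ => 1) A).trace = ∑ i, (s.1 i : ℂ) * (A i).trace := by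
  have h (B : Matrix (Σ i, Fin (s.1 i) × Fin (m i)) (Σ i, Fin (s.1 i) × Fin (m i)) ℂ) :
      (Matrix.reindex s.indexEquiv s.indexEquiv B).trace = B.trace := by
    simp only [Matrix.trace, Matrix.diag, Matrix.reindex_apply, Matrix.submatrix_apply]
    exact Equiv.sum_comp s.indexEquiv.symm fun p => B p p
  rw [block, h, Matrix.trace_blockDiagonal']
  simp [Matrix.trace_kronecker]

/-- The trace is invariant under conjugation, and on a rank-one projection of summand `i` it equals
the multiplicity `s i`. -/
theorem eq_of_conjHom_eq (hm : ∀ i, 0 < m i) {s t : BratteliTuple m n}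
    {U V : Matrix.unitaryGroup (Fin n) ℂ} (h : s.conjHom U = t.conjHom V) : s = t := by
  have htr (r : BratteliTuple m n) (W : Matrix.unitaryGroup (Fin n) ℂ) (A : MatSum m) :
      (r.conjHom W A 0).trace = ∑ i, (r.1 i : ℂ) * (A i).trace := by
    rw [conjHom_apply, Matrix.trace_mul_comm, ← mul_assoc,
      Unitary.star_mul_self_of_mem W.2, one_mul, trace_block]
  refine Subtype.ext (funext fun i => ?_)
  have key := htr s U (Pi.single i (Matrix.single ⟨0, hm i⟩ ⟨0, hm i⟩ 1))
  rw [h, htr] at key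
  have hs (r : BratteliTuple m n) : ∑ j, (r.1 j : ℂ) * ((Pi.single i
      (Matrix.single ⟨0, hm i⟩ ⟨0, hm i⟩ 1) : MatSum m) j).trace = r.1 i := by
    rw [Finset.sum_eq_single i]
    · simp
    · intro j _ hj
      simp [Pi.single_eq_of_ne hj]
    · simp
  rw [hs, hs] at key
  exact_mod_cast key.symm

/-- The commutant of `{⊕ i, 1 ⊗ A i}` consists of the matrices `⊕ i, u i ⊗ 1`. -/
theorem exists_eq_block_of_commute (hm : ∀ i, 0 < m i) (s : BratteliTuple m n)
    (W : Matrix (Fin n) (Fin n) ℂ) (hW : ∀ A : MatSum m, Commute W (s.block (fun _ => 1) A)) :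
    ∃ u, W = s.block u fun _ => 1 := by
  -- Commutation with the image of the matrix unit `E x y`: right multiplication by it puts column
  -- `(i, a, x)` of `W` in position `(i, a, y)`.
  have key (i : Fin k) (x y : Fin (m i)) (p : Σ i, Fin (s.1 i) × Fin (m i)) (a : Fin (s.1 i)) :
      W (s.indexEquiv p) (s.indexEquiv ⟨i, a, x⟩) =
        (s.block (fun _ => 1) (Pi.single i (Matrix.single x y 1)) * W)
          (s.indexEquiv p) (s.indexEquiv ⟨i, a, y⟩) := by
    rw [← (hW _).eq, Matrix.mul_apply, ← s.indexEquiv.sum_comp,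
      Finset.sum_eq_single (⟨i, a, x⟩ : Σ i, Fin (s.1 i) × Fin (m i))]
    · simp [block_apply]
    · rintro ⟨j, b, z⟩ _ hne
      by_cases hj : j = i
      · subst hj
        rw [block_apply]
        by_cases hb : b = a
        · subst hb
          have : x ≠ z := by rintro rfl; exact hne rfl
          simp [this]
        · simp [hb]
      · rw [block_apply_ne _ _ _ hj, mul_zero]
    · simp
  -- Left multiplication by `E x y` moves row `y` to row `x`, so the `i`-th diagonal block of `W` is
  -- scalar in the `m i` coordinate, with coefficient independent of `y`.
  have key_same (i : Fin k) (x y z : Fin (m i)) (a b : Fin (s.1 i)) :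
      W (s.indexEquiv ⟨i, b, z⟩) (s.indexEquiv ⟨i, a, x⟩) =
        (1 : Matrix _ _ ℂ) z x * W (s.indexEquiv ⟨i, b, y⟩) (s.indexEquiv ⟨i, a, y⟩) := by
    rw [key i x y, Matrix.mul_apply, ← s.indexEquiv.sum_comp,
      Finset.sum_eq_single (⟨i, b, y⟩ : Σ i, Fin (s.1 i) × Fin (m i))]
    · simp [block_apply, Matrix.single_apply, Matrix.one_apply, eq_comm]
    · rintro ⟨j, c, w⟩ _ hne
      by_cases hj : j = i
      · subst hj
        rw [block_apply]
        by_cases hb : b = c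
        · subst hb
          have : y ≠ w := by rintro rfl; exact hne rfl
          simp [this]
        · simp [hb]
      · rw [block_apply_ne _ _ _ (Ne.symm hj), zero_mul]
    · simp
  refine ⟨fun i => Matrix.of fun b a =>
    W (s.indexEquiv ⟨i, b, ⟨0, hm i⟩⟩) (s.indexEquiv ⟨i, a, ⟨0, hm i⟩⟩), ?_⟩
  ext p q
  obtain ⟨⟨j, b, z⟩, rfl⟩ := s.indexEquiv.surjective p
  obtain ⟨⟨i, a, x⟩, rfl⟩ := s.indexEquiv.surjective q
  by_cases hj : j = i
  · subst hj
    rw [block_apply, key_same j x ⟨0, hm j⟩, mul_comm]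
    rfl
  -- The image of `E x x` from summand `i` has zero rows in block `j ≠ i`.
  · rw [block_apply_ne _ _ _ hj, key i x x, Matrix.mul_apply, ← s.indexEquiv.sum_comp]
    refine Finset.sum_eq_zero fun r _ => ?_
    by_cases hr : j = r.1
    · obtain ⟨l, c, w⟩ := r
      obtain rfl : j = l := hr
      rw [block_apply, Pi.single_eq_of_ne hj]
      simp
    · rw [block_apply_ne _ _ _ hr, zero_mul]

theorem block_one_injective (hm : ∀ i, 0 < m i) (s : BratteliTuple m n) :
    Function.Injective fun u : ∀ i, Matrix (Fin (s.1 i)) (Fin (s.1 i)) ℂ =>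
      s.block u fun _ => 1 := by
  intro u v h
  funext i
  ext a b
  have := congrFun (congrFun h (s.indexEquiv ⟨i, a, ⟨0, hm i⟩⟩)) (s.indexEquiv ⟨i, b, ⟨0, hm i⟩⟩)
  simpa [block_apply] using this

/-- The commutant gives only matrices `u i`; they are unitary because `W * star W = 1` and `u ↦ ⊕ i,
u i ⊗ 1` is injective. -/
theorem mem_unitarySubgroup_of_commute (hm : ∀ i, 0 < m i) (s : BratteliTuple m n)
    (W : Matrix.unitaryGroup (Fin n) ℂ)
    (hW : ∀ A : MatSum m, Commute (W : Matrix (Fin n) (Fin n) ℂ) (s.block (fun _ => 1) A)) :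
    W ∈ s.unitarySubgroup := by
  obtain ⟨u, hu⟩ := s.exists_eq_block_of_commute hm _ hW
  have h : (fun i => u i * star (u i)) = fun _ => 1 := by
    refine s.block_one_injective hm ?_
    have := Unitary.mul_star_self_of_mem W.2
    rw [hu, star_block, block_mul] at this
    simpa [s.block_one] using this
  exact ⟨fun i => ⟨u i, Matrix.mem_unitaryGroup_iff.mpr (congrFun h i)⟩, hu⟩

theorem inv_mul_mem_of_conjHom_eq (hm : ∀ i, 0 < m i) (s : BratteliTuple m n)
    {U V : Matrix.unitaryGroup (Fin n) ℂ} (h : s.conjHom U = s.conjHom V) :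
    U⁻¹ * V ∈ s.unitarySubgroup := by
  refine s.mem_unitarySubgroup_of_commute hm _ fun A => ?_
  have hA : (U : Matrix (Fin n) (Fin n) ℂ) * s.block (fun _ => 1) A *
      star (U : Matrix (Fin n) (Fin n) ℂ) = (V : Matrix (Fin n) (Fin n) ℂ) *
      s.block (fun _ => 1) A * star (V : Matrix (Fin n) (Fin n) ℂ) :=
    congrFun (congrArg (fun f : CstarHom m (fun _ : Fin 1 => n) => f A) h) 0
  have hU := Unitary.star_mul_self_of_mem U.2
  have hV := Unitary.star_mul_self_of_mem V.2
  change star (U : Matrix (Fin n) (Fin n) ℂ) * (V : Matrix (Fin n) (Fin n) ℂ) * _ =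
    _ * (star (U : Matrix (Fin n) (Fin n) ℂ) * (V : Matrix (Fin n) (Fin n) ℂ))
  calc star (U : Matrix (Fin n) (Fin n) ℂ) * V * s.block (fun _ => 1) A
      = star (U : Matrix (Fin n) (Fin n) ℂ) *
        (V * s.block (fun _ => 1) A * star (V : Matrix (Fin n) (Fin n) ℂ)) * V := by
        simp only [mul_assoc, hV, mul_one]
    _ = star (U : Matrix (Fin n) (Fin n) ℂ) * U * s.block (fun _ => 1) A *
        (star (U : Matrix (Fin n) (Fin n) ℂ) * V) := by
        rw [← hA]
        simp only [mul_assoc]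
    _ = _ := by rw [hU, one_mul]

end BratteliTuple

/-! ### Matrix units of the direct sum. -/

section MatrixUnits

variable {k : ℕ} {m : Fin k → ℕ}

/-- The matrix unit `E x y` of the summand `i`. -/
def MatSum.single (i : Fin k) (x y : Fin (m i)) : MatSum m :=
  Pi.single i (Matrix.single x y 1)

namespace MatSum

theorem single_mul_single (i : Fin k) (x y z : Fin (m i)) :
    MatSum.single i x y * MatSum.single i y z = MatSum.single i x z := by
  rw [MatSum.single, MatSum.single, ← Pi.single_mul]
  simp [MatSum.single]

theorem single_mul_single_of_ne (i : Fin k) {x y y' z : Fin (m i)} (h : y ≠ y') :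
    MatSum.single i x y * MatSum.single i y' z = 0 := by
  rw [MatSum.single, MatSum.single, ← Pi.single_mul]
  simp [h]

theorem single_mul_single_of_index_ne {i j : Fin k} (h : i ≠ j) (x y : Fin (m i))
    (z w : Fin (m j)) : MatSum.single i x y * MatSum.single j z w = 0 := by
  funext l
  by_cases hl : l = i
  · subst hl
    simp [MatSum.single, Pi.single_eq_of_ne h]
  · simp [MatSum.single, Pi.single_eq_of_ne hl]

theorem star_single (i : Fin k) (x y : Fin (m i)) :
    star (MatSum.single i x y) = MatSum.single i y x := by
  funext l
  by_cases hl : l = i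
  · subst hl
    simp [MatSum.single, Matrix.star_eq_conjTranspose]
  · simp [MatSum.single, Pi.single_eq_of_ne hl]

theorem eq_sum_single (A : MatSum m) : A = ∑ i, ∑ x, ∑ y, A i x y • MatSum.single i x y := by
  funext l
  simp only [Finset.sum_apply, Pi.smul_apply]
  rw [Finset.sum_eq_single l]
  · conv_lhs => rw [Matrix.matrix_eq_sum_single (A l)]
    simp [MatSum.single]
  · intro j _ hj
    simp [MatSum.single, Pi.single_eq_of_ne hj.symm]
  · simp

theorem one_eq_sum_single : (1 : MatSum m) = ∑ i, ∑ x, MatSum.single i x x := by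
  rw [eq_sum_single 1]
  refine Finset.sum_congr rfl fun i _ => Finset.sum_congr rfl fun x _ => ?_
  rw [Finset.sum_eq_single x]
  · simp
  · intro y _ hy
    simp [hy.symm]
  · simp

end MatSum

end MatrixUnits

/-! ### Decomposition of finite-dimensional representations. -/

section Representation

variable {k : ℕ} {m : Fin k → ℕ} {E : Type*} [NormedAddCommGroup E] [InnerProductSpace ℂ E]
  [FiniteDimensional ℂ E]

local notation "⟪" x ", " y "⟫" => inner ℂ x y

/-- A unital `*`-representation of `⊕ i, M_{m i}(ℂ)` on a finite-dimensional Hilbert space is, in a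
suitable orthonormal basis, given by the action on a direct sum of multiples of the standard
representations. -/
theorem exists_orthonormalBasis_of_representation (hm : ∀ i, 0 < m i)
    (φ : MatSum m →⋆ₐ[ℂ] (E →L[ℂ] E)) :
    ∃ (s : Fin k → ℕ) (b : OrthonormalBasis (Σ i, Fin (s i) × Fin (m i)) ℂ E),
      ∀ (A : MatSum m) (i : Fin k) (a : Fin (s i)) (x : Fin (m i)),
        φ A (b ⟨i, a, x⟩) = ∑ y, A i y x • b ⟨i, a, y⟩ := by
  let r (i : Fin k) : Fin (m i) := ⟨0, hm i⟩
  -- The rank of the projection `φ (E r r)` is the multiplicity of summand `i`. The partial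
  -- isometries `φ (E x r)` carry an orthonormal basis of its range to the ranges of the `φ (E x
  -- x)`.
  let H (i : Fin k) : Submodule ℂ E := (φ (MatSum.single i (r i) (r i))).toLinearMap.range
  let w (i : Fin k) := stdOrthonormalBasis ℂ (H i)
  let v (p : Σ i, Fin (Module.finrank ℂ (H i)) × Fin (m i)) : E :=
    φ (MatSum.single p.1 p.2.2 (r p.1)) (w p.1 p.2.1)
  have hmul (A B : MatSum m) (e : E) : φ A (φ B e) = φ (A * B) e := by
    rw [map_mul]
    rfl
  have hfix (i : Fin k) (e : H i) : φ (MatSum.single i (r i) (r i)) e = e := by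
    obtain ⟨e, e', rfl⟩ := e
    change φ _ (φ _ e') = φ _ e'
    rw [hmul, MatSum.single_mul_single]
  have hinner (A B : MatSum m) (e e' : E) : ⟪φ A e, φ B e'⟫ = ⟪e, φ (star A * B) e'⟫ := by
    rw [← hmul, map_star, ContinuousLinearMap.star_eq_adjoint,
      ContinuousLinearMap.adjoint_inner_right]
  have hv : Orthonormal ℂ v := by
    rw [orthonormal_iff_ite]
    rintro ⟨i, a, x⟩ ⟨j, b, y⟩
    simp only [v, hinner, MatSum.star_single]
    by_cases hij : i = j
    · subst hij
      by_cases hxy : x = y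
      · subst hxy
        rw [MatSum.single_mul_single, hfix]
        have := orthonormal_iff_ite.mp (w i).orthonormal a b
        rw [Submodule.coe_inner] at this
        rw [this]
        simp
      · rw [MatSum.single_mul_single_of_ne i hxy]
        simp [hxy]
    · rw [MatSum.single_mul_single_of_index_ne hij]
      simp [hij]
  have hspan : ⊤ ≤ Submodule.span ℂ (Set.range v) := by
    intro e _
    -- This is `1 = ∑ i, ∑ x, E x r * E r x`, where each `φ (E r x) e` lies in `H i`.
    have he : e = ∑ i, ∑ x, φ (MatSum.single i x (r i)) (φ (MatSum.single i (r i) x) e) := by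
      simp only [hmul, MatSum.single_mul_single]
      have h1 : φ (∑ i, ∑ x, MatSum.single i x x) e = e := by
        rw [← MatSum.one_eq_sum_single, map_one]
        rfl
      conv_lhs => rw [← h1]
      simp [map_sum]
    rw [he]
    refine Submodule.sum_mem _ fun i _ => Submodule.sum_mem _ fun x _ => ?_
    have hmem : φ (MatSum.single i (r i) x) e ∈ H i :=
      ⟨φ (MatSum.single i (r i) x) e, by
        change φ _ (φ _ e) = _
        rw [hmul, MatSum.single_mul_single]⟩
    have hsum := congrArg Subtype.val ((w i).sum_repr ⟨_, hmem⟩)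
    rw [Submodule.coe_sum] at hsum
    change _ = φ (MatSum.single i (r i) x) e at hsum
    rw [← hsum, map_sum]
    refine Submodule.sum_mem _ fun a _ => ?_
    rw [Submodule.coe_smul, map_smul]
    exact Submodule.smul_mem _ _ (Submodule.subset_span ⟨⟨i, a, x⟩, rfl⟩)
  refine ⟨fun i => Module.finrank ℂ (H i), OrthonormalBasis.mk hv hspan, fun A i a x => ?_⟩
  simp only [OrthonormalBasis.coe_mk]
  have hA : A * MatSum.single i x (r i) = ∑ y, A i y x • MatSum.single i y (r i) := by
    funext l
    by_cases hl : l = i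
    · subst hl
      ext y z
      simp only [MatSum.single, Pi.mul_apply, Pi.single_eq_same, Finset.sum_apply, Pi.smul_apply,
        Matrix.sum_apply, Matrix.smul_apply, Matrix.mul_apply, Matrix.single_apply, smul_eq_mul]
      by_cases hz : r l = z <;> simp [hz]
    · simp [MatSum.single, Pi.single_eq_of_ne hl]
  simp only [v, hmul]
  rw [hA]
  simp [map_sum]

end Representation

/-! ### Surjectivity and passage to the quotients. -/

namespace BratteliTuple

variable {k : ℕ} {m : Fin k → ℕ} {n : ℕ}

theorem exists_conjHom_eq (hm : ∀ i, 0 < m i) (f : CstarHom m (fun _ : Fin 1 => n)) :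
    ∃ (s : BratteliTuple m n) (U : Matrix.unitaryGroup (Fin n) ℂ), s.conjHom U = f := by
  let φ : MatSum m →⋆ₐ[ℂ] (EuclideanSpace ℂ (Fin n) →L[ℂ] EuclideanSpace ℂ (Fin n)) :=
    ((Matrix.toEuclideanCLM (n := Fin n) (𝕜 := ℂ) : _ →⋆ₐ[ℂ] _).comp
      (Pi.evalStarAlgHom ℂ (fun _ : Fin 1 => Matrix (Fin n) (Fin n) ℂ) 0)).comp f
  obtain ⟨s, b, hb⟩ := exists_orthonormalBasis_of_representation hm φ
  have hs : ∑ i, s i * m i = n := by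
    have := Module.finrank_eq_card_basis b.toBasis
    simpa using this.symm
  let t : BratteliTuple m n := ⟨s, hs⟩
  let c : OrthonormalBasis (Fin n) ℂ (EuclideanSpace ℂ (Fin n)) := b.reindex t.indexEquiv
  -- The columns of `U` are the adapted basis vectors in block order, so `key` below is the action
  -- formula `hb` read column by column.
  let U : Matrix.unitaryGroup (Fin n) ℂ := ⟨Matrix.of fun p q => c q p, by
    exact (EuclideanSpace.basisFun (Fin n) ℂ).toMatrix_orthonormalBasis_mem_unitary c⟩
  refine ⟨t, U, DFunLike.ext _ _ fun A => funext fun l => ?_⟩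
  obtain rfl : l = 0 := Subsingleton.elim _ _
  have key : f A 0 * (U : Matrix (Fin n) (Fin n) ℂ) =
      (U : Matrix (Fin n) (Fin n) ℂ) * t.block (fun _ => 1) A := by
    ext p q
    obtain ⟨⟨i, a, x⟩, rfl⟩ := t.indexEquiv.surjective q
    have hc (j : _) : c (t.indexEquiv j) = b j := by simp [c]
    have h1 : (f A 0 * (U : Matrix (Fin n) (Fin n) ℂ)) p (t.indexEquiv ⟨i, a, x⟩) =
        (φ A (b ⟨i, a, x⟩)) p := by
      rw [← hc]
      rfl
    rw [h1, hb, Matrix.mul_apply, ← t.indexEquiv.sum_comp, Fintype.sum_sigma,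
      Finset.sum_eq_single i, Fintype.sum_prod_type, Finset.sum_eq_single a]
    · simp [block_apply, U, hc, mul_comm]
    · intro a' _ ha'
      refine Finset.sum_eq_zero fun y _ => ?_
      simp [block_apply, ha']
    · simp
    · intro j _ hj
      refine Finset.sum_eq_zero fun y _ => ?_
      rw [block_apply_ne _ _ _ hj, mul_zero]
    · simp
  rw [conjHom_apply]
  change _ * _ * _ = _
  rw [← key, mul_assoc, Unitary.mul_star_self_of_mem U.2, mul_one]

/-- The map on `U(n)/G_s` induced by `conjHom`. -/
def quotientConjHom (s : BratteliTuple m n) :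
    Matrix.unitaryGroup (Fin n) ℂ ⧸ s.unitarySubgroup → CstarHom m (fun _ : Fin 1 => n) :=
  Quotient.lift s.conjHom fun U V h => by
    rw [← s.conjHom_mul_of_mem U _ (QuotientGroup.leftRel_apply.mp h), mul_inv_cancel_left]

theorem continuous_sigma_quotientConjHom :
    Continuous fun p : Σ s : BratteliTuple m n,
      Matrix.unitaryGroup (Fin n) ℂ ⧸ s.unitarySubgroup => p.1.quotientConjHom p.2 :=
  continuous_sigma fun s =>
    (isQuotientMap_quot_mk.continuous_iff (g := s.quotientConjHom)).mpr s.continuous_conjHom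

theorem bijective_sigma_quotientConjHom (hm : ∀ i, 0 < m i) :
    Function.Bijective fun p : Σ s : BratteliTuple m n,
      Matrix.unitaryGroup (Fin n) ℂ ⧸ s.unitarySubgroup => p.1.quotientConjHom p.2 := by
  constructor
  · rintro ⟨s, U⟩ ⟨t, V⟩ h
    obtain ⟨U, rfl⟩ := QuotientGroup.mk_surjective U
    obtain ⟨V, rfl⟩ := QuotientGroup.mk_surjective V
    change s.conjHom U = t.conjHom V at h
    obtain rfl := eq_of_conjHom_eq hm h
    rw [QuotientGroup.eq.mpr (s.inv_mul_mem_of_conjHom_eq hm h)]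
  · intro f
    obtain ⟨s, U, h⟩ := exists_conjHom_eq hm f
    exact ⟨⟨s, QuotientGroup.mk U⟩, h⟩

end BratteliTuple

theorem mainTheorem7 {k : ℕ} (m : Fin k → ℕ) (hm : ∀ i, 0 < m i) (n : ℕ) :
    ∃ e : (Σ s : BratteliTuple m n, Matrix.unitaryGroup (Fin n) ℂ ⧸ s.unitarySubgroup) ≃ₜ
        CstarHom m (fun _ : Fin 1 => n),
      ∀ (s : BratteliTuple m n) (U : Matrix.unitaryGroup (Fin n) ℂ) (A : MatSum m),
        e ⟨s, QuotientGroup.mk U⟩ A =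
          fun _ => (U : Matrix (Fin n) (Fin n) ℂ) * s.block (fun _ => 1) A *
            star (U : Matrix (Fin n) (Fin n) ℂ) := by
  have : Finite (BratteliTuple m n) := BratteliTuple.finite hm
  have (s : BratteliTuple m n) :
      CompactSpace (Matrix.unitaryGroup (Fin n) ℂ ⧸ s.unitarySubgroup) :=
    Quotient.compactSpace
  exact ⟨Continuous.homeoOfEquivCompactToT2
    (f := Equiv.ofBijective _ (BratteliTuple.bijective_sigma_quotientConjHom hm))
    BratteliTuple.continuous_sigma_quotientConjHom, fun s U A => rfl⟩
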